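/- Let $M^m$ be a compact smooth manifold and $N^n$ a smooth manifold, $m<n$ (Hausdorff, second countable, without boundary), and let $g$ be a Riemannian metric on $N$ with exponential map $\exp$. Let $\mathfrak C(M,\mathbb R)$ be a Banach space of functions on $M$ with $C^\infty(M,\mathbb R)\subset\mathfrak C(M,\mathbb R)\subset C^1(M,\mathbb R)$, the first inclusion being dense and the second continuous, which is stable under composition on the right with smooth maps $M\to M$ and on the left with smooth functions $h:\mathbb R\to\mathbb R$, and such that $c\mapsto h\circ c$ is a smooth map of $\mathfrak C(M,\mathbb R)$ for every such $h$. Fix a smooth embedding $\varphi:N\to\mathbb R^d$. A map $y:M\to N$ is of class $\mathfrak C$ if the components of $\varphi\circ y$ are in $\mathfrak C(M,\mathbb R)$; a section $u$ of $x^*(TN)$, where $x:M\to N$ is smooth, is of class $\mathfrak C$ if the components of $d\varphi(u)$ are in $\mathfrak C(M,\mathbb R)$. Let $\mathbf\Gamma(x^*(TN))$ be the normed space of these sections, with the norm of $d\varphi(u)$ in $\mathfrak C(M,\mathbb R)^d$. For a smooth embedding $x$, let $x^\perp\subset x^*(TN)$ be the normal bundle and let $\mathbf\Gamma(x^\perp)\subset\mathbf\Gamma(x^*(TN))$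 be the subspace of the sections with values in $x^\perp$. Let $\mathrm{Emb}(M,N)$ be the set of the embeddings $M\to N$ of class $\mathfrak C$, with the topology induced by $y\mapsto\varphi\circ y\in\mathfrak C(M,\mathbb R)^d$, and let $\widetilde{\mathrm{Emb}}(M,N)$ be the set of the classes $[y]$ of $y\in\mathrm{Emb}(M,N)$ modulo composition on the right with $C^1$-diffeomorphisms of $M$. For a smooth embedding $x:M\to N$ consider: * charts $\Phi_x$ of $\mathrm{Emb}(M,N)$ centered at $x$: homeomorphisms of an open neighborhood of $x$ onto an open neighborhood $W$ of $0$ in $\mathbf\Gamma(x^*(TN))$, with $\Phi_x(x)=0$ and $\Phi_x^{-1}(u)=\big(p\mapsto\exp_{x(p)}(u(p))\big)$ for $u\in W$, where the $u\in W$ take values in an open neighborhood $U$ of the zero section of $x^*(TN)$ on which $(p,v)\mapsto(p,\exp_{x(p)}v)$ is a diffeomorphism onto an open subset of $M\times N$; * charts $\widetilde\Phi_x$ of $\widetilde{\mathrm{Emb}}(M,N)$ centered at $[x]$: bijections of a subset of $\widetilde{\mathrm{Emb}}(M,N)$ containing $[x]$ onto an open neighborhood $\widetilde W$ of $0$ in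 $\mathbf\Gamma(x^\perp)$, with $\widetilde\Phi_x([x])=0$ and $\widetilde\Phi_x^{-1}(u)=\big[p\mapsto\exp_{x(p)}(u(p))\big]$ for $u\in\widetilde W$, where the $u\in\widetilde W$ take values in an open neighborhood of the zero section of $x^\perp$ that $\exp$ maps diffeomorphically onto an open subset of $N$. Let $f:\mathrm{Emb}(M,N)\to\mathbb R$ be smooth, i.e. such that $f\circ\Phi_{x'}^{-1}$ is of class $C^\infty$ for every chart $\Phi_{x'}$, $x'$ a smooth embedding, and invariant, i.e. $f(y)=f(y')$ if $[y]=[y']$; write $f$ also for the induced function on $\widetilde{\mathrm{Emb}}(M,N)$. Let $x:M\to N$ be a smooth embedding such that $[x]$ is a critical point of $f$ in $\widetilde{\mathrm{Emb}}(M,N)$, i.e. for every chart $\widetilde\Phi_{x'}$ whose domain contains $[x]$ the differential of $f\circ\widetilde\Phi_{x'}^{-1}$ vanishes at $\widetilde\Phi_{x'}([x])$. Then, for all charts $\Phi_x$ centered at $x$ and $\widetilde\Phi_x$ centered at $[x]$, the functions $f\circ\Phi_x^{-1}$ and $f\circ\widetilde\Phi_x^{-1}$ are $C^\infty$ near $0$,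 and the second variation $d^2(f\circ\widetilde\Phi_x^{-1})(0)$ is the restriction of $d^2(f\circ\Phi_x^{-1})(0)$ to $\mathbf\Gamma(x^\perp)$: $$d^2\big(f\circ\widetilde\Phi_x^{-1}\big)(0)(u,v)=d^2\big(f\circ\Phi_x^{-1}\big)(0)(u,v)\qquad\text{for all }u,v\in\mathbf\Gamma(x^\perp).$$ -/

import Mathlib

open Set Filter Topology Manifold Bundle
open scoped ContDiff

noncomputable section

namespace UnparamEmb

/-! ### Two facts on embeddings -/

section Immersion

variable {a b : ℕ} {X Y : Type*}
  [TopologicalSpace X] [ChartedSpace (EuclideanSpace ℝ (Fin a)) X]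
  [TopologicalSpace Y] [ChartedSpace (EuclideanSpace ℝ (Fin b)) Y]

/-- A smooth embedding is an embedding of class `C^1`. -/
theorem isSmoothEmbedding_one {f : X → Y} (hf : IsSmoothEmbedding (𝓡 a) (𝓡 b) ∞ f) :
    IsSmoothEmbedding (𝓡 a) (𝓡 b) 1 f := by
  refine ⟨?_, hf.isEmbedding⟩
  obtain ⟨F, i1, i2, hF⟩ := hf.isImmersion
  refine ⟨F, i1, i2, fun p => ?_⟩
  obtain ⟨L⟩ := hF p
  have h1 : (1 : WithTop ℕ∞) ≤ ∞ := by norm_cast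
  exact ⟨⟨L.domChart, L.codChart, L.mem_domChart_source, L.mem_codChart_source,
    IsManifold.maximalAtlas_subset_of_le h1 L.domChart_mem_maximalAtlas,
    IsManifold.maximalAtlas_subset_of_le h1 L.codChart_mem_maximalAtlas,
    L.source_subset_preimage_source, L.property⟩⟩

/-- The differential of an embedding is injective at every point. -/
theorem mfderiv_injective_of_isSmoothEmbedding [IsManifold (𝓡 a) ∞ X] [IsManifold (𝓡 b) ∞ Y]
    {f : X → Y} (hf : IsSmoothEmbedding (𝓡 a) (𝓡 b) 1 f) (p : X) :
    Function.Injective (mfderiv (𝓡 a) (𝓡 b) f p) := by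
  obtain ⟨F, i1, i2, hF⟩ := hf.isImmersion.isImmersionAt p
  set dom := hF.domChart with hdom
  set cod := hF.codChart with hcod
  have hp : p ∈ dom.source := hF.mem_domChart_source
  have hfp : f p ∈ cod.source := hF.mem_codChart_source
  let r : Y → X := fun y => (dom.extend (𝓡 a)).symm (hF.equiv.symm (cod.extend (𝓡 b) y)).1
  have hrf : r ∘ f =ᶠ[𝓝 p] id := by
    filter_upwards [dom.open_source.mem_nhds hp] with q hq
    have hq' : q ∈ (dom.extend (𝓡 a)).source := by simpa using hq
    have hw := hF.writtenInCharts ((dom.extend (𝓡 a)).map_source hq')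
    simp only [Function.comp_apply, ← hdom, ← hcod, (dom.extend (𝓡 a)).left_inv hq'] at hw
    simp only [r, Function.comp_apply, hw, ContinuousLinearEquiv.symm_apply_apply, id]
    exact (dom.extend (𝓡 a)).left_inv hq'
  have hval : (hF.equiv.symm (cod.extend (𝓡 b) (f p))).1 = dom.extend (𝓡 a) p := by
    have hq' : p ∈ (dom.extend (𝓡 a)).source := by simpa using hp
    have hw := hF.writtenInCharts ((dom.extend (𝓡 a)).map_source hq')
    simp only [Function.comp_apply, ← hdom, ← hcod, (dom.extend (𝓡 a)).left_inv hq'] at hw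
    rw [hw]; simp
  have h1 : MDifferentiableAt (𝓡 b) (𝓡 b) (cod.extend (𝓡 b)) (f p) :=
    (OpenPartialHomeomorph.contMDiffAt_extend hF.codChart_mem_maximalAtlas
      hfp).mdifferentiableAt one_ne_zero
  have h2 : MDifferentiableAt (𝓡 b) (𝓡 a)
      (fun z : EuclideanSpace ℝ (Fin b) => (hF.equiv.symm z).1) (cod.extend (𝓡 b) (f p)) :=
    ((ContinuousLinearMap.fst ℝ _ _).differentiableAt.comp _
      hF.equiv.symm.differentiableAt).mdifferentiableAt
  have h3 : MDifferentiableAt (𝓡 a) (𝓡 a) (dom.extend (𝓡 a)).symm (dom.extend (𝓡 a) p) := by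
    refine (((contMDiffOn_extend_symm hF.domChart_mem_maximalAtlas)
      (dom.extend (𝓡 a) p) ?_).contMDiffAt ?_).mdifferentiableAt one_ne_zero
    · exact ⟨dom p, dom.map_source hp, rfl⟩
    · have : (𝓡 a) '' dom.target = dom.target := by simp
      rw [this]
      exact dom.open_target.mem_nhds (dom.map_source hp)
  have hr : MDifferentiableAt (𝓡 b) (𝓡 a) r (f p) := by
    have h3' : MDifferentiableAt (𝓡 a) (𝓡 a) (dom.extend (𝓡 a)).symm
        (hF.equiv.symm (cod.extend (𝓡 b) (f p))).1 := by rw [hval]; exact h3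
    exact h3'.comp (f p) (h2.comp (f p) h1)
  have hd : MDifferentiableAt (𝓡 a) (𝓡 b) f p :=
    (hf.contMDiff p).mdifferentiableAt one_ne_zero
  have hc : (mfderiv (𝓡 b) (𝓡 a) r (f p)).comp (mfderiv (𝓡 a) (𝓡 b) f p)
      = mfderiv (𝓡 a) (𝓡 a) (id : X → X) p := by
    rw [← hrf.mfderiv_eq, mfderiv_comp p hr hd]
  intro v w hvw
  have := congrArg (mfderiv (𝓡 b) (𝓡 a) r (f p)) hvw
  have e1 := congrArg (fun T => T v) hc
  have e2 := congrArg (fun T => T w) hc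
  rw [mfderiv_id] at e1 e2
  exact (e1.symm.trans this).trans e2

end Immersion

/-! ### Regularity classes -/

/-- A regularity class `𝔠(M, ℝ)` of real functions on the manifold `M`: the Banach space `C`, whose
elements `c` are functions `toFun c : M → ℝ`, with
`C^∞(M, ℝ) ⊆ 𝔠(M, ℝ) ⊆ C^1(M, ℝ)`, the first inclusion being dense and the second continuous,
stable under right composition with smooth maps `M → M` and under left composition with smooth
functions `ℝ → ℝ`, left composition with such a function being a smooth map of `𝔠(M, ℝ)`. -/
structure RegularityClass (m : ℕ) (M : Type*) [TopologicalSpace M]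
    [ChartedSpace (EuclideanSpace ℝ (Fin m)) M] [IsManifold (𝓡 m) ∞ M]
    (C : Type*) [NormedAddCommGroup C] [NormedSpace ℝ C] where
  /-- The function on `M` given by an element of the space. -/
  toFun : C →ₗ[ℝ] (M → ℝ)
  injective : Function.Injective toFun
  complete : CompleteSpace C
  smooth_mem : ∀ h : M → ℝ, ContMDiff (𝓡 m) 𝓘(ℝ, ℝ) ∞ h → ∃ c, toFun c = h
  dense_smooth : Dense {c | ContMDiff (𝓡 m) 𝓘(ℝ, ℝ) ∞ (toFun c)}
  contMDiff_one : ∀ c, ContMDiff (𝓡 m) 𝓘(ℝ, ℝ) 1 (toFun c)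
  /-- Continuity of the inclusion into `C^1(M, ℝ)`: the values and the first derivatives are bounded
  by the norm, uniformly on compact sets of tangent vectors. -/
  bound_one : ∀ K : Set (TangentBundle (𝓡 m) M), IsCompact K → ∃ A : ℝ, ∀ c, ∀ e ∈ K,
    |toFun c e.1| ≤ A * ‖c‖ ∧ |mvfderiv (𝓡 m) (toFun c) e.1 e.2| ≤ A * ‖c‖
  comp_right : ∀ h : M → M, ContMDiff (𝓡 m) (𝓡 m) ∞ h → ∀ c, ∃ c', toFun c' = toFun c ∘ h
  comp_left : ∀ h : ℝ → ℝ, ContDiff ℝ ∞ h →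
    ∃ L : C → C, ContDiff ℝ ∞ L ∧ ∀ c, toFun (L c) = h ∘ toFun c

/-- A smooth embedding of the manifold `N` into `ℝ^d`. -/
structure EuclideanEmbedding (n d : ℕ) (N : Type*) [TopologicalSpace N]
    [ChartedSpace (EuclideanSpace ℝ (Fin n)) N] where
  toFun : N → EuclideanSpace ℝ (Fin d)
  isSmoothEmbedding : IsSmoothEmbedding (𝓡 n) (𝓡 d) ∞ toFun

section Main

variable {m n d : ℕ}
  {M : Type*} [TopologicalSpace M] [ChartedSpace (EuclideanSpace ℝ (Fin m)) M]
  [IsManifold (𝓡 m) ∞ M]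
  {N : Type*} [TopologicalSpace N] [ChartedSpace (EuclideanSpace ℝ (Fin n)) N]
  [IsManifold (𝓡 n) ∞ N]
  {C : Type*} [NormedAddCommGroup C] [NormedSpace ℝ C]

/-- Smooth Riemannian metrics on `N`. -/
abbrev Metric (n : ℕ) (N : Type*) [TopologicalSpace N]
    [ChartedSpace (EuclideanSpace ℝ (Fin n)) N] [IsManifold (𝓡 n) ∞ N] :=
  ContMDiffRiemannianMetric (𝓡 n) ∞ (EuclideanSpace ℝ (Fin n))
    (fun q : N => TangentSpace (𝓡 n) q)

/-! ### The exponential map of a Riemannian metric -/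

/-- The metric read in the chart at `q`, at the point `z` of the model space. -/
def chartMetric (g : Metric n N) (q : N) (z v w : EuclideanSpace ℝ (Fin n)) : ℝ :=
  g.inner ((extChartAt (𝓡 n) q).symm z)
    (mfderiv (𝓡 n) (𝓡 n) (extChartAt (𝓡 n) q).symm z v)
    (mfderiv (𝓡 n) (𝓡 n) (extChartAt (𝓡 n) q).symm z w)

/-- The Christoffel symbol of the first kind of the Levi-Civita connection, in the chart at `q`:
`Γ(u, v; w) = (∂_u g(v, w) + ∂_v g(u, w) - ∂_w g(u, v)) / 2`. -/
def christoffel (g : Metric n N) (q : N) (z u v w : EuclideanSpace ℝ (Fin n)) : ℝ :=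
  (fderiv ℝ (fun z' => chartMetric g q z' v w) z u
    + fderiv ℝ (fun z' => chartMetric g q z' u w) z v
    - fderiv ℝ (fun z' => chartMetric g q z' u v) z w) / 2

/-- `γ` is a geodesic on the open set `s` of times: in the chart at `γ t`, the curve `c` given
by `γ` satisfies `g(c'', w) + Γ(c', c'; w) = 0` at time `t` for all `w`. -/
def IsGeodesicOn (g : Metric n N) (γ : ℝ → N) (s : Set ℝ) : Prop :=
  ContMDiffOn 𝓘(ℝ, ℝ) (𝓡 n) ∞ γ s ∧
  ∀ t ∈ s, ∀ w : EuclideanSpace ℝ (Fin n),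
    let c : ℝ → EuclideanSpace ℝ (Fin n) := fun τ => extChartAt (𝓡 n) (γ t) (γ τ)
    chartMetric g (γ t) (c t) (deriv (deriv c) t) w
      + christoffel g (γ t) (c t) (deriv c t) (deriv c t) w = 0

/-- There is a geodesic with initial velocity `ξ`, defined on a neighborhood of `[0, 1]`, which is
at `y` at time `1`. -/
def IsExp (g : Metric n N) (ξ : TangentBundle (𝓡 n) N) (y : N) : Prop :=
  ∃ (γ : ℝ → N) (s : Set ℝ), IsOpen s ∧ Icc 0 1 ⊆ s ∧ IsGeodesicOn g γ s ∧
    (⟨γ 0, mfderiv 𝓘(ℝ, ℝ) (𝓡 n) γ 0 (1 : ℝ)⟩ : TangentBundle (𝓡 n) N) = ξ ∧ γ 1 = y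

/-- The set of tangent vectors at which the exponential map is defined. -/
def expDomain (g : Metric n N) : Set (TangentBundle (𝓡 n) N) := {ξ | ∃ y, IsExp g ξ y}

open Classical in
/-- The exponential map of the metric `g` (the base point, outside of its domain). -/
def expMap (g : Metric n N) (ξ : TangentBundle (𝓡 n) N) : N :=
  if h : ∃ y, IsExp g ξ y then h.choose else ξ.1

/-! ### Embeddings of class `𝔠`, parameterized and unparameterized -/

/-- `y : M → N` is of class `𝔠`: the components of `φ ∘ y : M → ℝ^d` are in `𝔠(M, ℝ)`. -/
def IsOfClass (R : RegularityClass m M C) (φ : EuclideanEmbedding n d N) (y : M → N) : Prop :=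
  ∀ i, ∃ c, R.toFun c = fun p => φ.toFun (y p) i

/-- The set `Emb(M, N)` of embeddings of class `𝔠`. -/
structure Emb (R : RegularityClass m M C) (φ : EuclideanEmbedding n d N) where
  toFun : M → N
  isOfClass : IsOfClass R φ toFun
  isEmbedding : IsSmoothEmbedding (𝓡 m) (𝓡 n) 1 toFun

/-- The element `φ ∘ y` of `𝔠(M, ℝ^d) = 𝔠(M, ℝ)^d`. -/
def Emb.coord {R : RegularityClass m M C} {φ : EuclideanEmbedding n d N} (y : Emb R φ) :
    Fin d → C :=
  fun i => (y.isOfClass i).choose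

/-- The topology of `Emb(M, N)`, induced from `𝔠(M, ℝ^d)`. -/
instance (R : RegularityClass m M C) (φ : EuclideanEmbedding n d N) : TopologicalSpace (Emb R φ) :=
  TopologicalSpace.induced Emb.coord inferInstance

/-- Two embeddings are equivalent if they differ by a `C^1`-diffeomorphism of `M`. -/
def embSetoid (R : RegularityClass m M C) (φ : EuclideanEmbedding n d N) : Setoid (Emb R φ) where
  r x y := ∃ ψ : Diffeomorph (𝓡 m) (𝓡 m) M M 1, y.toFun = x.toFun ∘ ψ
  iseqv :=
    { refl := fun _ => ⟨Diffeomorph.refl _ _ _, rfl⟩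
      symm := fun {x y} ⟨ψ, h⟩ => ⟨ψ.symm, by rw [h]; ext p; simp⟩
      trans := fun {x y z} ⟨ψ, h⟩ ⟨ψ', h'⟩ => ⟨ψ'.trans ψ, by rw [h', h]; rfl⟩ }

/-- The set of unparameterized embeddings of class `𝔠`. -/
def UEmb (R : RegularityClass m M C) (φ : EuclideanEmbedding n d N) : Type _ :=
  Quotient (embSetoid R φ)

/-- The class `[y]` of an embedding. -/
def Emb.cls {R : RegularityClass m M C} {φ : EuclideanEmbedding n d N} (y : Emb R φ) : UEmb R φ :=
  Quotient.mk (embSetoid R φ) y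

/-- `f` is invariant: it takes the same value at equivalent embeddings. -/
def IsInvariant {R : RegularityClass m M C} {φ : EuclideanEmbedding n d N} (f : Emb R φ → ℝ) :
    Prop :=
  ∀ x y : Emb R φ, (embSetoid R φ).r x y → f x = f y

/-- The function induced on unparameterized embeddings by an invariant function. -/
def descend {R : RegularityClass m M C} {φ : EuclideanEmbedding n d N} (f : Emb R φ → ℝ)
    (hf : IsInvariant f) : UEmb R φ → ℝ :=
  Quotient.lift f hf

/-- Smooth embeddings `x : M → N`. -/
structure SmoothEmb (m n : ℕ) (M : Type*) [TopologicalSpace M]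
    [ChartedSpace (EuclideanSpace ℝ (Fin m)) M] (N : Type*) [TopologicalSpace N]
    [ChartedSpace (EuclideanSpace ℝ (Fin n)) N] where
  toMap : C^∞⟮𝓡 m, M; 𝓡 n, N⟯
  isSmoothEmbedding : IsSmoothEmbedding (𝓡 m) (𝓡 n) ∞ toMap

/-- A smooth embedding is an embedding of class `𝔠`. -/
def SmoothEmb.toEmb (R : RegularityClass m M C) (φ : EuclideanEmbedding n d N)
    (x : SmoothEmb m n M N) : Emb R φ where
  toFun := x.toMap
  isOfClass i := R.smooth_mem _ <|
    (EuclideanSpace.proj (𝕜 := ℝ) i).contDiff.contMDiff.comp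
      (φ.isSmoothEmbedding.contMDiff.comp x.toMap.contMDiff)
  isEmbedding := isSmoothEmbedding_one x.isSmoothEmbedding

/-! ### Sections of class `𝔠` of `x^*(TN)` and of the normal bundle -/

/-- The differential of `φ` along `x`, applied to a section `u` of `x^*(TN)`. -/
def diffCoord (φ : EuclideanEmbedding n d N) (x : M → N) (u : ∀ p : M, TangentSpace (𝓡 n) (x p))
    (p : M) : EuclideanSpace ℝ (Fin d) :=
  mvfderiv (𝓡 n) φ.toFun (x p) (u p)

/-- The linear space of sections `u` of `x^*(TN)` of class `𝔠`. The differential of `φ` makes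
`x^*(TN)` a smooth subbundle of the trivial bundle `M × ℝ^d`, and `u` is of class `𝔠` if its
`d` components are. -/
def sectionSubmodule (R : RegularityClass m M C) (φ : EuclideanEmbedding n d N) (x : M → N) :
    Submodule ℝ (∀ p : M, TangentSpace (𝓡 n) (x p)) where
  carrier := {u | ∀ i, ∃ c, R.toFun c = fun p => diffCoord φ x u p i}
  zero_mem' i := ⟨0, by ext p; simp [diffCoord]⟩
  add_mem' {u v} hu hv i := by
    obtain ⟨c, hc⟩ := hu i
    obtain ⟨c', hc'⟩ := hv i
    exact ⟨c + c', by ext p; simp [diffCoord, hc, hc']⟩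
  smul_mem' a u hu i := by
    obtain ⟨c, hc⟩ := hu i
    exact ⟨a • c, by ext p; simp [diffCoord, hc]⟩

/-- The space `𝚪(x^*(TN))` of sections of class `𝔠` of `x^*(TN)`. -/
def Sections (R : RegularityClass m M C) (φ : EuclideanEmbedding n d N) (x : M → N) : Type _ :=
  sectionSubmodule R φ x

instance (R : RegularityClass m M C) (φ : EuclideanEmbedding n d N) (x : M → N) :
    AddCommGroup (Sections R φ x) :=
  inferInstanceAs (AddCommGroup (sectionSubmodule R φ x))

instance (R : RegularityClass m M C) (φ : EuclideanEmbedding n d N) (x : M → N) :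
    Module ℝ (Sections R φ x) :=
  inferInstanceAs (Module ℝ (sectionSubmodule R φ x))

/-- The value of a section at a point. -/
def Sections.val {R : RegularityClass m M C} {φ : EuclideanEmbedding n d N} {x : M → N}
    (u : Sections R φ x) (p : M) : TangentSpace (𝓡 n) (x p) :=
  Subtype.val u p

/-- The components of a section, as an element of `𝔠(M, ℝ)^d`. -/
def Sections.coord (R : RegularityClass m M C) (φ : EuclideanEmbedding n d N) (x : M → N) :
    Sections R φ x →ₗ[ℝ] (Fin d → C) where
  toFun u i := (u.2 i).choose
  map_add' u v := by
    ext i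
    apply R.injective
    rw [Pi.add_apply, map_add, ((u + v).2 i).choose_spec, (u.2 i).choose_spec,
      (v.2 i).choose_spec]
    ext p
    change diffCoord φ x (u.1 + v.1) p i = _
    simp [diffCoord]
  map_smul' a u := by
    ext i
    apply R.injective
    rw [Pi.smul_apply, map_smul, ((a • u).2 i).choose_spec]
    simp only [RingHom.id_apply, (u.2 i).choose_spec]
    ext p
    change diffCoord φ x (a • u.1) p i = _
    simp [diffCoord]

theorem Sections.coord_apply (R : RegularityClass m M C) (φ : EuclideanEmbedding n d N)
    (x : M → N) (u : Sections R φ x) (i : Fin d) :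
    R.toFun (Sections.coord R φ x u i) = fun p => diffCoord φ x u.val p i :=
  (u.2 i).choose_spec

theorem Sections.coord_injective (R : RegularityClass m M C) (φ : EuclideanEmbedding n d N)
    (x : M → N) : Function.Injective (Sections.coord R φ x) := by
  intro u v h
  apply Subtype.ext
  funext p
  apply mfderiv_injective_of_isSmoothEmbedding (isSmoothEmbedding_one φ.isSmoothEmbedding) (x p)
  change (diffCoord φ x u.val p : EuclideanSpace ℝ (Fin d)) = diffCoord φ x v.val p
  ext i
  have h1 := congrFun (Sections.coord_apply R φ x u i) p
  have h2 := congrFun (Sections.coord_apply R φ x v i) p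
  rw [h] at h1
  exact h1.symm.trans h2

/-- The norm of a section is the norm of its components in `𝔠(M, ℝ)^d`. -/
instance (R : RegularityClass m M C) (φ : EuclideanEmbedding n d N) (x : M → N) :
    NormedAddCommGroup (Sections R φ x) :=
  NormedAddCommGroup.induced _ (Fin d → C) (Sections.coord R φ x) (Sections.coord_injective R φ x)

instance (R : RegularityClass m M C) (φ : EuclideanEmbedding n d N) (x : M → N) :
    NormedSpace ℝ (Sections R φ x) :=
  NormedSpace.induced ℝ _ (Fin d → C) (Sections.coord R φ x)

/-- The vector `v` at `x p` is orthogonal to `dx(T_p M)`. -/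
def IsNormalAt (g : Metric n N) (x : M → N) (p : M) (v : TangentSpace (𝓡 n) (x p)) : Prop :=
  ∀ w : TangentSpace (𝓡 m) p, g.inner (x p) (mfderiv (𝓡 m) (𝓡 n) x p w) v = 0

/-- The space `𝚪(x^⊥)` of sections of class `𝔠` of the normal bundle, as the subspace of
`𝚪(x^*(TN))` of the sections with values in the normal bundle. -/
def NormalSections (g : Metric n N) (R : RegularityClass m M C) (φ : EuclideanEmbedding n d N)
    (x : M → N) : Submodule ℝ (Sections R φ x) where
  carrier := {u | ∀ p, IsNormalAt (m := m) g x p (u.val p)}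
  zero_mem' _ _ := map_zero _
  add_mem' {u v} hu hv p w := by
    change g.inner (x p) _ (u.val p + v.val p) = 0
    rw [map_add, hu p w, hv p w, add_zero]
  smul_mem' a u hu p w := by
    change g.inner (x p) _ (a • u.val p) = 0
    rw [map_smul, hu p w, smul_zero]

/-! ### Vector bundle neighborhoods and tubular neighborhoods -/

/-- The total space of `x^*(TN)`. -/
abbrev PullTotal (x : SmoothEmb m n M N) : Type _ :=
  TotalSpace (EuclideanSpace ℝ (Fin n)) ((x.toMap : M → N) *ᵖ (TangentSpace (𝓡 n) : N → Type))

/-- A vector of `x^*(TN)`, as a tangent vector of `N`. -/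
def PullTotal.lift {x : SmoothEmb m n M N} (e : PullTotal x) : TangentBundle (𝓡 n) N :=
  ⟨x.toMap e.1, e.2⟩

/-- `U` is an open neighborhood of the zero section of `x^*(TN)` which the map
`(p, v) ↦ (p, exp_{x(p)} v)` sends diffeomorphically onto an open subset of `M × N`. -/
def IsBundleNhd (g : Metric n N) (x : SmoothEmb m n M N) (U : Set (PullTotal x)) : Prop :=
  (∀ p, (⟨p, 0⟩ : PullTotal x) ∈ U) ∧
  (∀ e ∈ U, e.lift ∈ expDomain g) ∧
  ∃ Θ : OpenPartialHomeomorph (PullTotal x) (M × N), Θ.source = U ∧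
    (∀ e ∈ U, Θ e = (e.1, expMap g e.lift)) ∧
    ContMDiffOn ((𝓡 m).prod (𝓡 n)) ((𝓡 m).prod (𝓡 n)) ∞ Θ Θ.source ∧
    ContMDiffOn ((𝓡 m).prod (𝓡 n)) ((𝓡 m).prod (𝓡 n)) ∞ Θ.symm Θ.target

/-- `U` is an open neighborhood of the zero section of the normal bundle `x^⊥ ⊆ x^*(TN)` which
the exponential map sends diffeomorphically onto an open subset `V` of `N`. -/
def IsTubularNhd (g : Metric n N) (x : SmoothEmb m n M N) (U : Set (PullTotal x)) : Prop :=
  (∃ O : Set (PullTotal x), IsOpen O ∧ U = {e ∈ O | IsNormalAt (m := m) g x.toMap e.1 e.2}) ∧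
  (∀ p, (⟨p, 0⟩ : PullTotal x) ∈ U) ∧
  (∀ e ∈ U, e.lift ∈ expDomain g) ∧
  ContMDiffOn ((𝓡 m).prod (𝓡 n)) (𝓡 n) ∞ (fun e : PullTotal x => expMap g e.lift) U ∧
  ∃ (V : Set N) (σ : N → PullTotal x), IsOpen V ∧
    BijOn (fun e : PullTotal x => expMap g e.lift) U V ∧
    LeftInvOn σ (fun e : PullTotal x => expMap g e.lift) U ∧
    ContMDiffOn (𝓡 n) ((𝓡 m).prod (𝓡 n)) ∞ σ V

/-! ### The charts, smooth functions and critical points -/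

variable {R : RegularityClass m M C} {φ : EuclideanEmbedding n d N}

/-- The map `p ↦ exp_{x(p)}(u(p))`. -/
def expSection (g : Metric n N) (x : SmoothEmb m n M N) (u : Sections R φ x.toMap) : M → N :=
  fun p => expMap g ⟨x.toMap p, u.val p⟩

/-- `Φ` is a local chart `Φ_x` of `Emb(M, N)` centered at the smooth embedding `x`:
a homeomorphism of an open neighborhood of `x` onto an open neighborhood of `0` in `𝚪(x^*(TN))`,
consisting of sections with values in a vector bundle neighborhood, with inverse
`u ↦ (p ↦ exp_{x(p)}(u(p)))`. -/
def IsChart (g : Metric n N) (x : SmoothEmb m n M N)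
    (Φ : OpenPartialHomeomorph (Emb R φ) (Sections R φ x.toMap)) : Prop :=
  x.toEmb R φ ∈ Φ.source ∧ Φ (x.toEmb R φ) = 0 ∧
  ∃ U, IsBundleNhd g x U ∧ ∀ u ∈ Φ.target,
    (∀ p, (⟨p, u.val p⟩ : PullTotal x) ∈ U) ∧ (Φ.symm u).toFun = expSection g x u

/-- `Φ` is a local chart of the set of unparameterized embeddings, centered at the class `[x]` of a
smooth embedding: a bijection of a set containing `[x]` onto an open neighborhood of `0` in
`𝚪(x^⊥)`, consisting of sections with values in a tubular neighborhood, with inverse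
`u ↦ [p ↦ exp_{x(p)}(u(p))]`. (The topology of the set of unparameterized embeddings is the one for
which all these bijections are homeomorphisms between open sets.) -/
def IsUChart (g : Metric n N) (x : SmoothEmb m n M N)
    (Φ : PartialEquiv (UEmb R φ) (NormalSections g R φ x.toMap)) : Prop :=
  (x.toEmb R φ).cls ∈ Φ.source ∧ Φ (x.toEmb R φ).cls = 0 ∧ IsOpen Φ.target ∧
  ∃ U, IsTubularNhd g x U ∧ ∀ u ∈ Φ.target,
    (∀ p, (⟨p, u.1.val p⟩ : PullTotal x) ∈ U) ∧
    ∃ y : Emb R φ, y.toFun = expSection g x u.1 ∧ Φ.symm u = y.cls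

/-- `f : Emb(M, N) → ℝ` is smooth: it is smooth in all the charts `Φ_x`. -/
def IsSmooth (g : Metric n N) (f : Emb R φ → ℝ) : Prop :=
  ∀ (x : SmoothEmb m n M N) (Φ : OpenPartialHomeomorph (Emb R φ) (Sections R φ x.toMap)),
    IsChart g x Φ → ContDiffOn ℝ ∞ (f ∘ Φ.symm) Φ.target

/-- `z` is a critical point of the function `F` on unparameterized embeddings: in every chart around
`z`, the differential of `F` vanishes at the point corresponding to `z`. -/
def IsCritical (g : Metric n N) (F : UEmb R φ → ℝ) (z : UEmb R φ) : Prop :=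
  ∀ (x : SmoothEmb m n M N) (Φ : PartialEquiv (UEmb R φ) (NormalSections g R φ x.toMap)),
    IsUChart g x Φ → z ∈ Φ.source →
    HasFDerivAt (F ∘ Φ.symm) (0 : NormalSections g R φ x.toMap →L[ℝ] ℝ) (Φ z)

/-- The second variation `d²F(u)` of a function on a normed space. -/
abbrev secondVariation {E : Type*} [NormedAddCommGroup E] [NormedSpace ℝ E] (F : E → ℝ) (u : E) :
    E →L[ℝ] E →L[ℝ] ℝ :=
  fderiv ℝ (fderiv ℝ F) u

end Main

end UnparamEmb

end

/-!
Both charts are inverse to `u ↦ (p ↦ exp_{x(p)} (u p))`, the chart of unparameterized embeddings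
being the one that only takes normal sections and passes to classes afterwards. Since `f` is
invariant, its expression in `Φt` is therefore, near `0`, the composition of its expression in `Φ`
with the continuous linear inclusion of the normal sections into all sections
(`descend_comp_symm_eventuallyEq`). Precomposition with a continuous linear map preserves
smoothness and restricts the second derivative (`secondVariation_comp_clm_zero`).
-/

namespace UnparamEmb

/-- The second variation of `F ∘ L`, for `L` linear, is the pullback by `L` of that of `F`: the
chain rule has no term in `dF` because `L` has no second derivative. -/
theorem secondVariation_comp_clm_zero {E E' : Type*} [NormedAddCommGroup E] [NormedSpace ℝ E]
    [NormedAddCommGroup E'] [NormedSpace ℝ E'] {F : E → ℝ} (L : E' →L[ℝ] E)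
    (hF : ContDiffAt ℝ 2 F 0) (u v : E') :
    secondVariation (F ∘ L) 0 u v = secondVariation F 0 (L u) (L v) := by
  have hL : Tendsto L (𝓝 0) (𝓝 0) := by simpa using L.continuous.tendsto 0
  have h1 : ∀ᶠ z in 𝓝 (0 : E), DifferentiableAt ℝ F z := by
    filter_upwards [hF.eventually (by simp)] with z hz
    exact hz.differentiableAt two_ne_zero
  have h2 : fderiv ℝ (F ∘ L) =ᶠ[𝓝 0] fun w => (fderiv ℝ F (L w)).comp L := by
    filter_upwards [hL.eventually h1] with w hw
    rw [fderiv_comp w hw L.differentiableAt, L.fderiv]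
  have h3 : HasFDerivAt (fderiv ℝ F) (fderiv ℝ (fderiv ℝ F) 0) (L 0) := by
    rw [map_zero]
    exact ((hF.fderiv_right (m := 1) (by norm_num)).differentiableAt one_ne_zero).hasFDerivAt
  have h4 : HasFDerivAt (fun w => (fderiv ℝ F (L w)).comp L)
      (((ContinuousLinearMap.compL ℝ E' E ℝ).flip L).comp
        ((fderiv ℝ (fderiv ℝ F) 0).comp L)) 0 :=
    ((ContinuousLinearMap.compL ℝ E' E ℝ).flip L).hasFDerivAt.comp 0
      (h3.comp 0 L.hasFDerivAt)
  rw [secondVariation, h2.fderiv_eq, h4.fderiv]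
  rfl

section Charts

variable {m n d : ℕ}
  {M : Type*} [TopologicalSpace M] [ChartedSpace (EuclideanSpace ℝ (Fin m)) M]
  [IsManifold (𝓡 m) ∞ M]
  {N : Type*} [TopologicalSpace N] [ChartedSpace (EuclideanSpace ℝ (Fin n)) N]
  {C : Type*} [NormedAddCommGroup C] [NormedSpace ℝ C]
  {R : RegularityClass m M C} {φ : EuclideanEmbedding n d N}

theorem Emb.toFun_injective : Function.Injective (Emb.toFun : Emb R φ → M → N) := by
  rintro ⟨_, _, _⟩ ⟨_, _, _⟩ rfl
  rfl

variable [IsManifold (𝓡 n) ∞ N] {g : Metric n N} {x : SmoothEmb m n M N}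
  {Φ : OpenPartialHomeomorph (Emb R φ) (Sections R φ x.toMap)}
  {Φt : PartialEquiv (UEmb R φ) (NormalSections g R φ x.toMap)}

theorem IsChart.target_mem_nhds_zero (hΦ : IsChart g x Φ) : Φ.target ∈ 𝓝 0 :=
  Φ.open_target.mem_nhds (hΦ.2.1 ▸ Φ.map_source hΦ.1)

theorem IsUChart.target_mem_nhds_zero (hΦt : IsUChart g x Φt) : Φt.target ∈ 𝓝 0 :=
  hΦt.2.2.1.mem_nhds (hΦt.2.1 ▸ Φt.map_source hΦt.1)

/-- Where both inverse charts are defined, that of unparameterized embeddings sends a normal section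
to the class of the embedding given by the other one. -/
theorem IsUChart.symm_apply_eq_cls (hΦt : IsUChart g x Φt) (hΦ : IsChart g x Φ)
    {u : NormalSections g R φ x.toMap} (hut : u ∈ Φt.target)
    (hu : (u : Sections R φ x.toMap) ∈ Φ.target) : Φt.symm u = (Φ.symm u).cls := by
  obtain ⟨-, -, U, -, hU⟩ := hΦ
  obtain ⟨-, -, -, V, -, hV⟩ := hΦt
  obtain ⟨-, y, hy, hyc⟩ := hV u hut
  rw [hyc, Emb.toFun_injective (hy.trans (hU u hu).2.symm)]

theorem descend_comp_symm_eventuallyEq {f : Emb R φ → ℝ} (hinv : IsInvariant f)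
    (hΦ : IsChart g x Φ) (hΦt : IsUChart g x Φt) :
    descend f hinv ∘ Φt.symm =ᶠ[𝓝 0]
      (f ∘ Φ.symm) ∘ (NormalSections g R φ x.toMap).subtypeL := by
  have hι : Tendsto (NormalSections g R φ x.toMap).subtypeL (𝓝 0) (𝓝 0) := by
    simpa using (NormalSections g R φ x.toMap).subtypeL.continuous.tendsto 0
  filter_upwards [hΦt.target_mem_nhds_zero, hι hΦ.target_mem_nhds_zero] with u hut hu
  exact congrArg (descend f hinv) (hΦt.symm_apply_eq_cls hΦ hut hu)

end Charts

end UnparamEmb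

theorem proposition4p7 {m n d : ℕ} (hmn : m < n)
    {M : Type*} [TopologicalSpace M] [ChartedSpace (EuclideanSpace ℝ (Fin m)) M]
    [IsManifold (𝓡 m) ∞ M] [T2Space M] [CompactSpace M]
    {N : Type*} [TopologicalSpace N] [ChartedSpace (EuclideanSpace ℝ (Fin n)) N]
    [IsManifold (𝓡 n) ∞ N] [T2Space N] [SecondCountableTopology N]
    (g : UnparamEmb.Metric n N) (φ : UnparamEmb.EuclideanEmbedding n d N)
    {C : Type*} [NormedAddCommGroup C] [NormedSpace ℝ C] (R : UnparamEmb.RegularityClass m M C)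
    (f : UnparamEmb.Emb R φ → ℝ) (hf : UnparamEmb.IsSmooth g f)
    (hinv : UnparamEmb.IsInvariant f)
    (x : UnparamEmb.SmoothEmb m n M N)
    (hx : UnparamEmb.IsCritical g (UnparamEmb.descend f hinv) (x.toEmb R φ).cls)
    (Φ : OpenPartialHomeomorph (UnparamEmb.Emb R φ) (UnparamEmb.Sections R φ x.toMap))
    (hΦ : UnparamEmb.IsChart g x Φ)
    (Φt : PartialEquiv (UnparamEmb.UEmb R φ) (UnparamEmb.NormalSections g R φ x.toMap))
    (hΦt : UnparamEmb.IsUChart g x Φt) :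
    ContDiffAt ℝ ∞ (f ∘ Φ.symm) 0 ∧
    ContDiffAt ℝ ∞ (UnparamEmb.descend f hinv ∘ Φt.symm) 0 ∧
    ∀ u v : UnparamEmb.NormalSections g R φ x.toMap,
      UnparamEmb.secondVariation (UnparamEmb.descend f hinv ∘ Φt.symm) 0 u v =
        UnparamEmb.secondVariation (f ∘ Φ.symm) 0
          (u : UnparamEmb.Sections R φ x.toMap) (v : UnparamEmb.Sections R φ x.toMap) := by
  have hF : ContDiffAt ℝ ∞ (f ∘ Φ.symm) 0 := (hf x Φ hΦ).contDiffAt hΦ.target_mem_nhds_zero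
  have hG := UnparamEmb.descend_comp_symm_eventuallyEq hinv hΦ hΦt
  refine ⟨hF, ContDiffAt.congr_of_eventuallyEq ?_ hG, fun u v => ?_⟩
  · refine ContDiffAt.comp _ ?_ (ContinuousLinearMap.contDiff _).contDiffAt
    rwa [map_zero]
  · rw [UnparamEmb.secondVariation, hG.fderiv.fderiv_eq]
    exact UnparamEmb.secondVariation_comp_clm_zero
      (UnparamEmb.NormalSections g R φ x.toMap).subtypeL (hF.of_le (by norm_cast)) u v
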